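/- For $p\in[1,\infty]$ let $\|\cdot\|_p$ be the standard norm of $L_p([-1,1])$ (real-valued functions, Lebesgue measure). For $r\in\mathbb N$, $r\ge 1$, let $L_2^r$ be the space of functions $f:[-1,1]\to\mathbb R$ whose derivative $f^{(r-1)}$ exists and is absolutely continuous on $[-1,1]$ (derivatives at $\pm1$ being one-sided) and whose $r$-th derivative $f^{(r)}$, which then exists almost everywhere, belongs to $L_2([-1,1])$. Put $W_2^r=\{f\in L_2^r:\ \|f^{(r)}\|_2\le 1\}$. For an integer $0\le k\le r-1$ let $\Gamma=\Gamma(D^k;L_2^r)$ be the set of all pairs $(A,B)$ of non-negative real numbers such that $$\|f^{(k)}\|_\infty\le A\|f\|_2+B\|f^{(r)}\|_2\quad\text{for all } f\in L_2^r,\qquad\text{and}\qquad B=\sup_{f\in W_2^r}\bigl(\|f^{(k)}\|_\infty-A\|f\|_2\bigr),$$ and let $\Gamma_{-1}=\Gamma(D^k_{-1};L_2^r)$ be the set of all pairs $(A,B)$ of non-negative real numbers such that $$|f^{(k)}(-1)|\le A\|f\|_2+B\|f^{(r)}\|_2\quad\text{for all } f\in L_2^r,\qquad\text{and}\qquad B=\sup_{f\in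 W_2^r}\bigl(|f^{(k)}(-1)|-A\|f\|_2\bigr).$$ Theorem. Let either $r=1$ and $k=0$, or $r=2$ and $k\in\{0,1\}$. Then $\Gamma=\Gamma_{-1}$. -/

import Mathlib

open MeasureTheory Set
open scoped ENNReal

noncomputable section

/-- The interval `[-1, 1]`. -/
def unitI : Set ℝ := Icc (-1) 1

/-- The `k`-th derivative `f^{(k)}` on `[-1, 1]` (one-sided at the endpoints). Only the values of
`f` on `[-1, 1]` matter. -/
def dI (k : ℕ) (f : ℝ → ℝ) : ℝ → ℝ := iteratedDerivWithin k f unitI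

/-- The standard norm of `L_p([-1, 1])`. -/
def normI (p : ℝ≥0∞) (f : ℝ → ℝ) : ℝ := (eLpNorm f p (volume.restrict unitI)).toReal

/-- The space `L_s^r` (for `r ≥ 1`): functions on `[-1, 1]` whose derivative `f^{(r-1)}` exists and
is absolutely continuous, and whose derivative `f^{(r)}` (which then exists almost everywhere)
lies in `L_s`. -/
def SpaceL (s : ℝ≥0∞) (r : ℕ) : Set (ℝ → ℝ) :=
  {f | ContDiffOn ℝ ((r - 1 : ℕ) : WithTop ℕ∞) f unitI ∧
    AbsolutelyContinuousOnInterval (dI (r - 1) f) (-1) 1 ∧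
    MemLp (dI r f) s (volume.restrict unitI)}

/-- The class `W_s^r` of all `f ∈ L_s^r` with `‖f^{(r)}‖_s ≤ 1`. -/
def ClassW (s : ℝ≥0∞) (r : ℕ) : Set (ℝ → ℝ) :=
  {f | f ∈ SpaceL s r ∧ normI s (dI r f) ≤ 1}

/-- The set of all pairs `(A, B)` of non-negative numbers such that the inequality
`T f ≤ A ‖f‖_p + B ‖f^{(r)}‖_s` holds for every `f ∈ L_s^r`, and such that it is sharp:
`B = sup {T f - A ‖f‖_p : f ∈ W_s^r}`. -/
def sharpPairs (p s : ℝ≥0∞) (r : ℕ) (T : (ℝ → ℝ) → ℝ) : Set (ℝ × ℝ) :=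
  {P | 0 ≤ P.1 ∧ 0 ≤ P.2 ∧
    (∀ f ∈ SpaceL s r, T f ≤ P.1 * normI p f + P.2 * normI s (dI r f)) ∧
    IsLUB {y : ℝ | ∃ f ∈ ClassW s r, y = T f - P.1 * normI p f} P.2}

/-- `Γ(D^k; L_2^r)`: sharp pairs in `‖f^{(k)}‖_∞ ≤ A ‖f‖_2 + B ‖f^{(r)}‖_2`. -/
def Gam (r k : ℕ) : Set (ℝ × ℝ) :=
  sharpPairs 2 2 r (fun f => normI ∞ (dI k f))

/-- `Γ_t = Γ(D_t^k; L_2^r)`: sharp pairs in `|f^{(k)}(t)| ≤ A ‖f‖_2 + B ‖f^{(r)}‖_2`. -/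
def GamAt (r k : ℕ) (t : ℝ) : Set (ℝ × ℝ) :=
  sharpPairs 2 2 r (fun f => |dI k f t|)

end

/-! By homogeneity, the supremum condition says that `B` is the least constant admissible for `A`
(`mem_upperBounds_sharp_iff`). Hence both sets are determined by which additive inequalities hold,
and it suffices to carry an inequality at `-1` over to every `t` in `[-1, 1]`; continuity of
`f^{(k)}` identifies the uniform norm with the supremum over `t`.

The transfer goes through quadratic inequalities. For `c > 0` consider the least energy `c ‖f‖² +
‖f^{(r)}‖²` subject to `f^{(k)}(t) = 1`. If for every `c` this is smallest at `t = -1` and attained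
there (`IsEndpointExtremal`), Cauchy–Schwarz with weights adapted to the given norms turns the
additive inequality at `-1` into a quadratic one, moves it to `t`, and returns with no loss
(`abs_dI_le_of_endpoint_of_pos`).

The least energy is bounded below by splitting the interval at `t` and solving a Riccati equation on
each side, with zero data at the free ends. For `r = 1` this gives `ω (tanh (ω (1 + t)) + tanh (ω (1
- t)))`. For `r = 2` it gives a quadratic form in value and slope (`stiffForm`); eliminating the
variable that is not prescribed leaves a constant divided by an expression which addition formulas
show to be largest at the endpoints (`le_stiffForm`). Explicit solutions of the Euler–Lagrange
equation attain the bounds at `-1`. -/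

/-! ### Hyperbolic and trigonometric inequalities -/

lemma abs_sin_lt_sinh {x : ℝ} (hx : 0 < x) : |Real.sin x| < Real.sinh x :=
  (Real.abs_sin_le_abs.trans_eq (abs_of_pos hx)).trans_lt (Real.self_lt_sinh_iff.2 hx)

lemma abs_sin_le_sinh {x : ℝ} (hx : 0 ≤ x) : |Real.sin x| ≤ Real.sinh x := by
  rcases hx.eq_or_lt with rfl | h
  · simp
  · exact (abs_sin_lt_sinh h).le

lemma two_lt_cosh_add_cos {x : ℝ} (hx : 0 < x) : 2 < Real.cosh x + Real.cos x := by
  have h := abs_sin_lt_sinh (half_pos hx)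
  have h2 := sq_lt_sq' (neg_lt_of_abs_lt h) (lt_of_abs_lt h)
  have e1 := Real.cosh_two_mul (x / 2)
  have e2 := Real.cos_two_mul (x / 2)
  have e3 := Real.cosh_sq (x / 2)
  have e4 := Real.sin_sq_add_cos_sq (x / 2)
  rw [mul_div_cancel₀ x two_ne_zero] at e1 e2
  linarith

lemma two_le_cosh_add_cos {x : ℝ} (hx : 0 ≤ x) : 2 ≤ Real.cosh x + Real.cos x := by
  rcases hx.eq_or_lt with rfl | h
  · norm_num
  · exact (two_lt_cosh_add_cos h).le

lemma cosh_add_cos_add_two_pos (x : ℝ) : 0 < Real.cosh x + Real.cos x + 2 := by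
  linarith [Real.cosh_pos x, Real.neg_one_le_cos x]

/-- Factorwise comparison: `|sin x| ≤ sinh x` and `1 - cos y ≤ cosh y - 1`. The brackets are what
remains when the addition formulas are expanded in the next two lemmas. -/
lemma abs_sin_mul_le_sinh_mul {x y : ℝ} (hx : 0 ≤ x) (hy : 0 ≤ y) :
    |Real.sin x * (3 * (1 - Real.cos y) + (Real.cosh y - 1))| ≤
      Real.sinh x * (3 * (Real.cosh y - 1) + (1 - Real.cos y)) := by
  have h1 := two_le_cosh_add_cos hy
  have h2 := Real.cos_le_one y
  have h3 := Real.one_le_cosh y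
  rw [abs_mul, abs_of_nonneg (a := 3 * (1 - Real.cos y) + (Real.cosh y - 1)) (by linarith)]
  exact mul_le_mul (abs_sin_le_sinh hx) (by linarith) (by linarith) (Real.sinh_nonneg_iff.2 hx)

/-- With `x + y` fixed, equality holds when `x = 0` or `y = 0`; this, and its companion with plus
signs, is where the endpoints become extremal. -/
lemma sinh_sub_sin_mul_add_le {x y : ℝ} (hx : 0 ≤ x) (hy : 0 ≤ y) :
    (Real.sinh x - Real.sin x) * (Real.cosh y + Real.cos y + 2) +
      (Real.sinh y - Real.sin y) * (Real.cosh x + Real.cos x + 2) ≤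
      4 * (Real.sinh (x + y) - Real.sin (x + y)) := by
  have h1 := neg_le_of_abs_le (abs_sin_mul_le_sinh_mul hx hy)
  have h2 := neg_le_of_abs_le (abs_sin_mul_le_sinh_mul hy hx)
  rw [Real.sinh_add, Real.sin_add]
  linarith

lemma sinh_add_sin_mul_add_le {x y : ℝ} (hx : 0 ≤ x) (hy : 0 ≤ y) :
    (Real.sinh x + Real.sin x) * (Real.cosh y + Real.cos y + 2) +
      (Real.sinh y + Real.sin y) * (Real.cosh x + Real.cos x + 2) ≤
      4 * (Real.sinh (x + y) + Real.sin (x + y)) := by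
  have h1 := le_of_abs_le (abs_sin_mul_le_sinh_mul hx hy)
  have h2 := le_of_abs_le (abs_sin_mul_le_sinh_mul hy hx)
  rw [Real.sinh_add, Real.sin_add]
  linarith

/-- Up to scaling, the left side is the determinant of `stiffForm`. Apart from the common
denominators, the right side depends only on `x + y`, hence not on the splitting point. -/
lemma two_mul_sum_mul_sub_sq_eq (x y : ℝ) :
    2 * ((Real.sinh x + Real.sin x) * (Real.cosh y + Real.cos y + 2) +
          (Real.sinh y + Real.sin y) * (Real.cosh x + Real.cos x + 2)) *
        ((Real.sinh x - Real.sin x) * (Real.cosh y + Real.cos y + 2) +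
          (Real.sinh y - Real.sin y) * (Real.cosh x + Real.cos x + 2)) -
      ((Real.cosh x - Real.cos x) * (Real.cosh y + Real.cos y + 2) -
          (Real.cosh y - Real.cos y) * (Real.cosh x + Real.cos x + 2)) ^ 2 =
      4 * ((Real.cosh x + Real.cos x + 2) * (Real.cosh y + Real.cos y + 2)) *
        (Real.cosh (x + y) + Real.cos (x + y) - 2) := by
  rw [Real.cosh_add, Real.cos_add]
  linear_combination
    -2 * (Real.cosh y + Real.cos y + 2) ^ 2 * (Real.cosh_sq x + Real.sin_sq_add_cos_sq x) -
    2 * (Real.cosh x + Real.cos x + 2) ^ 2 * (Real.cosh_sq y + Real.sin_sq_add_cos_sq y)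

/-! ### The stiffness matrix of a beam with a free end

The entries of the quadratic form giving the least value of `∫ (f'' ^ 2 + 4 ω⁴ f ^ 2)` over an
interval of length `L` with prescribed value and slope at one end. -/

/-- The value-value entry of the stiffness matrix. -/
noncomputable def stiffP (ω L : ℝ) : ℝ :=
  4 * ω ^ 3 * (Real.sinh (2 * ω * L) + Real.sin (2 * ω * L)) /
    (Real.cosh (2 * ω * L) + Real.cos (2 * ω * L) + 2)

/-- The value-slope entry of the stiffness matrix. -/
noncomputable def stiffQ (ω L : ℝ) : ℝ :=
  2 * ω ^ 2 * (Real.cosh (2 * ω * L) - Real.cos (2 * ω * L)) /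
    (Real.cosh (2 * ω * L) + Real.cos (2 * ω * L) + 2)

/-- The slope-slope entry of the stiffness matrix. -/
noncomputable def stiffS (ω L : ℝ) : ℝ :=
  2 * ω * (Real.sinh (2 * ω * L) - Real.sin (2 * ω * L)) /
    (Real.cosh (2 * ω * L) + Real.cos (2 * ω * L) + 2)

@[simp] lemma stiffP_zero (ω : ℝ) : stiffP ω 0 = 0 := by simp [stiffP]

@[simp] lemma stiffQ_zero (ω : ℝ) : stiffQ ω 0 = 0 := by simp [stiffQ]

@[simp] lemma stiffS_zero (ω : ℝ) : stiffS ω 0 = 0 := by simp [stiffS]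

lemma hasDerivAt_two_mul_mul (ω L : ℝ) : HasDerivAt (fun L => 2 * ω * L) (2 * ω) L := by
  simpa using (hasDerivAt_id L).const_mul (2 * ω)

lemma hasDerivAt_stiff_denom (ω L : ℝ) :
    HasDerivAt (fun L => Real.cosh (2 * ω * L) + Real.cos (2 * ω * L) + 2)
      (Real.sinh (2 * ω * L) * (2 * ω) + -Real.sin (2 * ω * L) * (2 * ω)) L :=
  ((hasDerivAt_two_mul_mul ω L).cosh.add (hasDerivAt_two_mul_mul ω L).cos).add_const 2

/-- This and the next two lemmas form the matrix Riccati equation for the energy density `f'' ^ 2 +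
4 ω⁴ f ^ 2`. The zero values at `L = 0` express that the far end is free. -/
lemma hasDerivAt_stiffP (ω L : ℝ) :
    HasDerivAt (stiffP ω) (4 * ω ^ 4 - stiffQ ω L ^ 2) L := by
  have hx := hasDerivAt_two_mul_mul ω L
  have hD := (cosh_add_cos_add_two_pos (2 * ω * L)).ne'
  have h : HasDerivAt (stiffP ω) _ L :=
    ((hx.sinh.add hx.sin).const_mul (4 * ω ^ 3)).div (hasDerivAt_stiff_denom ω L) hD
  convert h using 1
  simp only [stiffQ, Pi.add_apply]
  clear hx h
  have h1 := Real.cosh_sq (2 * ω * L)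
  have h2 := Real.sin_sq_add_cos_sq (2 * ω * L)
  generalize 2 * ω * L = z at *
  field_simp
  linear_combination -8 * ω ^ 4 * (h1 + h2)

lemma hasDerivAt_stiffQ (ω L : ℝ) :
    HasDerivAt (stiffQ ω) (stiffP ω L - stiffQ ω L * stiffS ω L) L := by
  have hx := hasDerivAt_two_mul_mul ω L
  have hD := (cosh_add_cos_add_two_pos (2 * ω * L)).ne'
  have h : HasDerivAt (stiffQ ω) _ L :=
    ((hx.cosh.sub hx.cos).const_mul (2 * ω ^ 2)).div (hasDerivAt_stiff_denom ω L) hD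
  convert h using 1
  simp only [stiffP, stiffQ, stiffS, Pi.sub_apply]
  clear hx h
  generalize 2 * ω * L = z at *
  field_simp
  ring

lemma hasDerivAt_stiffS (ω L : ℝ) :
    HasDerivAt (stiffS ω) (2 * stiffQ ω L - stiffS ω L ^ 2) L := by
  have hx := hasDerivAt_two_mul_mul ω L
  have hD := (cosh_add_cos_add_two_pos (2 * ω * L)).ne'
  have h : HasDerivAt (stiffS ω) _ L :=
    ((hx.sinh.sub hx.sin).const_mul (2 * ω)).div (hasDerivAt_stiff_denom ω L) hD
  convert h using 1
  simp only [stiffQ, stiffS, Pi.sub_apply]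
  clear hx h
  generalize 2 * ω * L = z at *
  field_simp
  ring

/-- The form of the sum of the energies on both sides of a point with value `u` and slope `v`. -/
noncomputable def stiffForm (ω L₁ L₂ u v : ℝ) : ℝ :=
  stiffP ω L₁ * u ^ 2 - 2 * stiffQ ω L₁ * (u * v) + stiffS ω L₁ * v ^ 2 +
    (stiffP ω L₂ * u ^ 2 + 2 * stiffQ ω L₂ * (u * v) + stiffS ω L₂ * v ^ 2)

/-- Completing the square in `v` (respectively `u`) leaves the determinant over a diagonal entry.
The common denominators cancel, so the splitting point enters only through `Δ` (respectively `T`),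
which the addition inequalities bound by the endpoint value. -/
lemma le_stiffForm {ω L₁ L₂ : ℝ} (hω : 0 < ω) (h₁ : 0 ≤ L₁) (h₂ : 0 ≤ L₂) (h : L₁ + L₂ = 2)
    (u v : ℝ) :
    u ^ 2 * (2 * ω ^ 3 * (Real.cosh (4 * ω) + Real.cos (4 * ω) - 2)) ≤
        (Real.sinh (4 * ω) - Real.sin (4 * ω)) * stiffForm ω L₁ L₂ u v ∧
      v ^ 2 * (ω * (Real.cosh (4 * ω) + Real.cos (4 * ω) - 2)) ≤
        (Real.sinh (4 * ω) + Real.sin (4 * ω)) * stiffForm ω L₁ L₂ u v := by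
  have hxy : 4 * ω = 2 * ω * L₁ + 2 * ω * L₂ := by linear_combination -2 * ω * h
  have hx : 0 ≤ 2 * ω * L₁ := by positivity
  have hy : 0 ≤ 2 * ω * L₂ := by positivity
  have hpos : 0 < 2 * ω * L₁ + 2 * ω * L₂ := by linarith
  unfold stiffForm stiffP stiffQ stiffS
  rw [hxy]
  generalize 2 * ω * L₁ = x at *
  generalize 2 * ω * L₂ = y at *
  have hid := two_mul_sum_mul_sub_sq_eq x y
  have hΔ := sinh_sub_sin_mul_add_le hx hy
  have hT := sinh_add_sin_mul_add_le hx hy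
  have hD₁ := cosh_add_cos_add_two_pos x
  have hD₂ := cosh_add_cos_add_two_pos y
  have hx' := abs_le.1 (abs_sin_le_sinh hx)
  have hy' := abs_le.1 (abs_sin_le_sinh hy)
  have hpos2 : 0 < (Real.sinh x - Real.sin x) * (Real.cosh y + Real.cos y + 2) +
        (Real.sinh y - Real.sin y) * (Real.cosh x + Real.cos x + 2) ∧
      0 < (Real.sinh x + Real.sin x) * (Real.cosh y + Real.cos y + 2) +
        (Real.sinh y + Real.sin y) * (Real.cosh x + Real.cos x + 2) := by
    -- At least one of the two lengths is positive, and its summand is then strictly positive.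
    rcases hx.eq_or_lt with rfl | hx0
    · have := abs_lt.1 (abs_sin_lt_sinh (by linarith : 0 < y))
      norm_num
      constructor <;> linarith
    · have := abs_lt.1 (abs_sin_lt_sinh hx0)
      constructor
      · exact add_pos_of_pos_of_nonneg (mul_pos (by linarith) hD₂)
          (mul_nonneg (by linarith) hD₁.le)
      · exact add_pos_of_pos_of_nonneg (mul_pos (by linarith) hD₂)
          (mul_nonneg (by linarith) hD₁.le)
  obtain ⟨hΔ0, hT0⟩ := hpos2
  set C := Real.cosh (x + y) + Real.cos (x + y) - 2 with hC
  set D₁ := Real.cosh x + Real.cos x + 2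
  set D₂ := Real.cosh y + Real.cos y + 2
  set S := 4 * ω ^ 3 * (Real.sinh x + Real.sin x) / D₁ * u ^ 2 -
      2 * (2 * ω ^ 2 * (Real.cosh x - Real.cos x) / D₁) * (u * v) +
      2 * ω * (Real.sinh x - Real.sin x) / D₁ * v ^ 2 +
      (4 * ω ^ 3 * (Real.sinh y + Real.sin y) / D₂ * u ^ 2 +
      2 * (2 * ω ^ 2 * (Real.cosh y - Real.cos y) / D₂) * (u * v) +
      2 * ω * (Real.sinh y - Real.sin y) / D₂ * v ^ 2) with hS
  set Δ := (Real.sinh x - Real.sin x) * D₂ + (Real.sinh y - Real.sin y) * D₁ with hΔd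
  set T := (Real.sinh x + Real.sin x) * D₂ + (Real.sinh y + Real.sin y) * D₁ with hTd
  set K := (Real.cosh x - Real.cos x) * D₂ - (Real.cosh y - Real.cos y) * D₁ with hKd
  have hE : 0 < D₁ * D₂ := mul_pos hD₁ hD₂
  have hSE : S * (D₁ * D₂) = 4 * ω ^ 3 * T * u ^ 2 - 4 * ω ^ 2 * K * (u * v) +
      2 * ω * Δ * v ^ 2 := by
    rw [hS, hΔd, hTd, hKd]
    field_simp
    ring
  have hC0 : 0 ≤ C := by linarith [two_le_cosh_add_cos hpos.le]
  have e1 : 0 ≤ (2 * ω) * (D₁ * D₂) * (Δ * S - 8 * ω ^ 3 * C * u ^ 2) := by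
    have : (2 * ω) * (D₁ * D₂) * (Δ * S - 8 * ω ^ 3 * C * u ^ 2) =
        (2 * ω * Δ * v - 2 * ω ^ 2 * K * u) ^ 2 := by
      linear_combination 2 * ω * Δ * hSE + 4 * ω ^ 4 * u ^ 2 * hid
    rw [this]
    positivity
  have e2 : 0 ≤ (4 * ω ^ 3) * (D₁ * D₂) * (T * S - 4 * ω * C * v ^ 2) := by
    have : (4 * ω ^ 3) * (D₁ * D₂) * (T * S - 4 * ω * C * v ^ 2) =
        (4 * ω ^ 3 * T * u - 2 * ω ^ 2 * K * v) ^ 2 := by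
      linear_combination 4 * ω ^ 3 * T * hSE + 4 * ω ^ 4 * v ^ 2 * hid
    rw [this]
    positivity
  have f1 := nonneg_of_mul_nonneg_right e1 (by positivity)
  have f2 := nonneg_of_mul_nonneg_right e2 (by positivity)
  have hS0 : 0 ≤ S := by
    refine nonneg_of_mul_nonneg_right (a := Δ) ?_ hΔ0
    have : 0 ≤ 8 * ω ^ 3 * C * u ^ 2 := by positivity
    linarith
  constructor
  · linarith [mul_le_mul_of_nonneg_right hΔ hS0]
  · linarith [mul_le_mul_of_nonneg_right hT hS0]

/-! ### Energy estimates -/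

lemma absolutelyContinuousOnInterval_of_hasDerivAt {p p' : ℝ → ℝ}
    (h : ∀ x, HasDerivAt p (p' x) x) (hc : Continuous p') (a b : ℝ) :
    AbsolutelyContinuousOnInterval p a b := by
  refine ContDiffOn.absolutelyContinuousOnInterval (ContDiff.contDiffOn ?_)
  rw [contDiff_one_iff_deriv]
  refine ⟨fun x => (h x).differentiableAt, ?_⟩
  rwa [funext fun x => (h x).deriv]

lemma sub_le_integral_of_hasDerivAt_le {F φ : ℝ → ℝ} {a b : ℝ} (hab : a ≤ b)
    (hF : AbsolutelyContinuousOnInterval F a b) (hφ : IntervalIntegrable φ volume a b)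
    (h : ∀ᵐ x, x ∈ Ioo a b → ∃ d ≤ φ x, HasDerivAt F d x) :
    F b - F a ≤ ∫ x in a..b, φ x := by
  rw [← hF.integral_deriv_eq_sub]
  refine intervalIntegral.integral_mono_ae_restrict hab hF.intervalIntegrable_deriv hφ ?_
  rw [Filter.EventuallyLE, restrict_Ioo_eq_restrict_Icc.symm, ae_restrict_iff' measurableSet_Ioo]
  filter_upwards [h] with x hx hmem
  obtain ⟨d, hd, hdF⟩ := hx hmem
  rwa [hdF.deriv]

/-- Lower bound for the energy `∫ (g ^ 2 + c f ^ 2)`, `g = f'`, from a solution of the scalar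
Riccati equation. -/
lemma riccati_sub_le_integral_one {f g p : ℝ → ℝ} {a b c : ℝ} (hab : a ≤ b)
    (hf : AbsolutelyContinuousOnInterval f a b)
    (hd : ∀ᵐ x, x ∈ Ioo a b → HasDerivAt f (g x) x)
    (hi : IntervalIntegrable (fun x => c * f x ^ 2 + g x ^ 2) volume a b)
    (hp : ∀ x, HasDerivAt p (c - p x ^ 2) x) :
    p b * f b ^ 2 - p a * f a ^ 2 ≤ ∫ x in a..b, (c * f x ^ 2 + g x ^ 2) := by
  have cp : Continuous p := continuous_iff_continuousAt.2 fun x => (hp x).continuousAt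
  have ap := absolutelyContinuousOnInterval_of_hasDerivAt hp (by fun_prop) a b
  refine sub_le_integral_of_hasDerivAt_le (F := fun x => p x * f x ^ 2) hab ?_ hi ?_
  · simpa only [sq] using ap.fun_mul (hf.fun_mul hf)
  · filter_upwards [hd] with x hx hmem
    refine ⟨_, ?_, (hp x).mul ((hx hmem).pow 2)⟩
    norm_num
    -- By the Riccati equation, the integrand minus the derivative of `p f²` is exactly this square.
    linarith [sq_nonneg (g x - p x * f x)]

/-- Lower bound for the energy `∫ (h ^ 2 + c f ^ 2)`, `h = f''`, from a solution of the matrix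
Riccati equation. -/
lemma riccati_sub_le_integral_two {f g h p q s : ℝ → ℝ} {a b c : ℝ} (hab : a ≤ b)
    (hf : AbsolutelyContinuousOnInterval f a b) (hg : AbsolutelyContinuousOnInterval g a b)
    (hd : ∀ᵐ x, x ∈ Ioo a b → HasDerivAt f (g x) x)
    (hd' : ∀ᵐ x, x ∈ Ioo a b → HasDerivAt g (h x) x)
    (hi : IntervalIntegrable (fun x => c * f x ^ 2 + h x ^ 2) volume a b)
    (hp : ∀ x, HasDerivAt p (c - q x ^ 2) x)
    (hq : ∀ x, HasDerivAt q (-p x - q x * s x) x)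
    (hs : ∀ x, HasDerivAt s (-2 * q x - s x ^ 2) x) :
    (p b * f b ^ 2 + 2 * q b * (f b * g b) + s b * g b ^ 2) -
        (p a * f a ^ 2 + 2 * q a * (f a * g a) + s a * g a ^ 2) ≤
      ∫ x in a..b, (c * f x ^ 2 + h x ^ 2) := by
  have cp : Continuous p := continuous_iff_continuousAt.2 fun x => (hp x).continuousAt
  have cq : Continuous q := continuous_iff_continuousAt.2 fun x => (hq x).continuousAt
  have cs : Continuous s := continuous_iff_continuousAt.2 fun x => (hs x).continuousAt
  have ap := absolutelyContinuousOnInterval_of_hasDerivAt hp (by fun_prop) a b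
  have aq := absolutelyContinuousOnInterval_of_hasDerivAt hq (by fun_prop) a b
  have as := absolutelyContinuousOnInterval_of_hasDerivAt hs (by fun_prop) a b
  refine sub_le_integral_of_hasDerivAt_le
    (F := fun x => p x * f x ^ 2 + 2 * q x * (f x * g x) + s x * g x ^ 2) hab ?_ hi ?_
  · simpa only [sq] using ((ap.fun_mul (hf.fun_mul hf)).fun_add
      ((aq.const_mul 2).fun_mul (hf.fun_mul hg))).fun_add (as.fun_mul (hg.fun_mul hg))
  · filter_upwards [hd, hd'] with x hx hx' hmem
    have df := hx hmem
    have dg := hx' hmem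
    refine ⟨_, ?_, (((hp x).mul (df.pow 2)).add (((hq x).const_mul 2).mul (df.mul dg))).add
      ((hs x).mul (dg.pow 2))⟩
    norm_num
    -- Again the three Riccati equations make the difference of integrand and derivative exactly
    -- this square.
    linarith [sq_nonneg (h x - q x * f x - s x * g x)]

/-! ### The spaces `L_2^r` -/

lemma uniqueDiffOn_unitI : UniqueDiffOn ℝ unitI := uniqueDiffOn_Icc (by norm_num)

lemma unitI_mem_nhds {x : ℝ} (hx : x ∈ Ioo (-1 : ℝ) 1) : unitI ∈ nhds x :=
  Icc_mem_nhds hx.1 hx.2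

lemma dI_zero (f : ℝ → ℝ) : dI 0 f = f := iteratedDerivWithin_zero

lemma dI_succ (n : ℕ) (f : ℝ → ℝ) : dI (n + 1) f = derivWithin (dI n f) unitI :=
  funext fun _ => by simp only [dI, iteratedDerivWithin_succ]

lemma hasDerivAt_dI_succ {n : ℕ} {f : ℝ → ℝ} {x : ℝ} (hx : x ∈ Ioo (-1 : ℝ) 1)
    (h : DifferentiableAt ℝ (dI n f) x) : HasDerivAt (dI n f) (dI (n + 1) f x) x := by
  rw [dI_succ, derivWithin_of_mem_nhds (unitI_mem_nhds hx)]
  exact h.hasDerivAt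

lemma ae_hasDerivAt_dI_succ {n : ℕ} {f : ℝ → ℝ}
    (h : AbsolutelyContinuousOnInterval (dI n f) (-1) 1) :
    ∀ᵐ x, x ∈ Ioo (-1 : ℝ) 1 → HasDerivAt (dI n f) (dI (n + 1) f x) x := by
  filter_upwards [h.ae_differentiableAt] with x hx hmem
  rw [uIcc_of_le (by norm_num)] at hx
  exact hasDerivAt_dI_succ hmem (hx (Ioo_subset_Icc_self hmem))

lemma dI_eq_iteratedDeriv {f : ℝ → ℝ} (hf : ContDiff ℝ (⊤ : ℕ∞) f) (n : ℕ) {x : ℝ}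
    (hx : x ∈ unitI) : dI n f x = iteratedDeriv n f x :=
  iteratedDerivWithin_eq_iteratedDeriv uniqueDiffOn_unitI
    ((hf.of_le (by exact_mod_cast le_top)).contDiffAt) hx

lemma integrableOn_unitI_iff {f : ℝ → ℝ} :
    Integrable f (volume.restrict unitI) ↔ IntervalIntegrable f volume (-1) 1 :=
  (intervalIntegrable_iff_integrableOn_Icc_of_le (by norm_num)).symm

lemma ContinuousOn.memLp_unitI {f : ℝ → ℝ} (hf : ContinuousOn f unitI) (p : ℝ≥0∞) :
    MemLp f p (volume.restrict unitI) := by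
  obtain ⟨C, hC⟩ := isCompact_Icc.exists_bound_of_continuousOn hf
  have : IsFiniteMeasure (volume.restrict unitI) :=
    ⟨by rw [Measure.restrict_apply_univ]; exact measure_Icc_lt_top⟩
  exact MemLp.of_bound (hf.aestronglyMeasurable measurableSet_Icc) C
    ((ae_restrict_iff' measurableSet_Icc).2 (.of_forall hC))

lemma normI_two_sq {f : ℝ → ℝ} (hf : MemLp f 2 (volume.restrict unitI)) :
    normI 2 f ^ 2 = ∫ x in (-1)..1, f x ^ 2 := by
  have h0 : 0 ≤ ∫ x, f x ^ 2 ∂(volume.restrict unitI) := integral_nonneg fun x => sq_nonneg _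
  rw [normI, hf.eLpNorm_eq_integral_rpow_norm two_ne_zero ENNReal.ofNat_ne_top,
    intervalIntegral.integral_of_le (by norm_num), ← integral_Icc_eq_integral_Ioc]
  simp only [ENNReal.toReal_ofNat, Real.rpow_ofNat, Real.norm_eq_abs, sq_abs]
  rw [ENNReal.toReal_ofReal (by positivity), ← Real.rpow_natCast, ← Real.rpow_mul h0]
  norm_num
  rfl

lemma normI_nonneg (p : ℝ≥0∞) (f : ℝ → ℝ) : 0 ≤ normI p f := ENNReal.toReal_nonneg

lemma SpaceL.continuousOn_dI {s : ℝ≥0∞} {r k : ℕ} {f : ℝ → ℝ} (hf : f ∈ SpaceL s r)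
    (hk : k ≤ r - 1) : ContinuousOn (dI k f) unitI :=
  hf.1.continuousOn_iteratedDerivWithin (by exact_mod_cast hk) uniqueDiffOn_unitI

lemma SpaceL.energy_integrable {r : ℕ} {f : ℝ → ℝ} (hf : f ∈ SpaceL 2 r) (c : ℝ) :
    IntervalIntegrable (fun x => c * f x ^ 2 + dI r f x ^ 2) volume (-1) 1 := by
  have h0 := (hf.1.continuousOn).memLp_unitI 2
  exact integrableOn_unitI_iff.1 ((h0.integrable_sq.const_mul c).add hf.2.2.integrable_sq)

lemma SpaceL.energy_eq {r : ℕ} {f : ℝ → ℝ} (hf : f ∈ SpaceL 2 r) (c : ℝ) :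
    c * normI 2 f ^ 2 + normI 2 (dI r f) ^ 2 =
      ∫ x in (-1)..1, (c * f x ^ 2 + dI r f x ^ 2) := by
  have h0 := (hf.1.continuousOn).memLp_unitI 2
  rw [normI_two_sq h0, normI_two_sq hf.2.2, intervalIntegral.integral_add,
    intervalIntegral.integral_const_mul]
  · exact integrableOn_unitI_iff.1 (h0.integrable_sq.const_mul c)
  · exact integrableOn_unitI_iff.1 hf.2.2.integrable_sq

/-! ### Lower bounds for the energy in terms of the data at a point -/

lemma uIcc_subset_of_mem_unitI {t : ℝ} (ht : t ∈ unitI) :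
    uIcc (-1) t ⊆ uIcc (-1 : ℝ) 1 ∧ uIcc t 1 ⊆ uIcc (-1 : ℝ) 1 := by
  have h1 : (-1 : ℝ) ≤ t := ht.1
  have h2 : t ≤ 1 := ht.2
  rw [uIcc_of_le h1, uIcc_of_le h2, uIcc_of_le (by norm_num)]
  exact ⟨Icc_subset_Icc_right h2, Icc_subset_Icc_left h1⟩

/-- Lower bound for the first order energy given the value at a point. -/
lemma SpaceL.tanh_mul_sq_le_energy {f : ℝ → ℝ} (hf : f ∈ SpaceL 2 1) {ω : ℝ} (hω : 0 < ω)
    {t : ℝ} (ht : t ∈ unitI) :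
    ω * Real.tanh (2 * ω) * f t ^ 2 ≤
      ω ^ 2 * normI 2 f ^ 2 + normI 2 (dI 1 f) ^ 2 := by
  have h1 : (-1 : ℝ) ≤ t := ht.1
  have h2 : t ≤ 1 := ht.2
  obtain ⟨hl, hr⟩ := uIcc_subset_of_mem_unitI ht
  have hac : AbsolutelyContinuousOnInterval f (-1) 1 := by simpa [dI_zero] using hf.2.1
  have hd : ∀ᵐ x, x ∈ Ioo (-1 : ℝ) 1 → HasDerivAt f (dI 1 f x) x := by
    simpa [dI_zero] using ae_hasDerivAt_dI_succ (n := 0) (by simpa [dI_zero] using hac)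
  have hi := SpaceL.energy_integrable hf (ω ^ 2)
  have hil := hi.mono_set hl
  have hir := hi.mono_set hr
  have dt (x : ℝ) : HasDerivAt (fun x => ω * Real.tanh (ω * x))
      (ω ^ 2 - (ω * Real.tanh (ω * x)) ^ 2) x := by
    have hc := (Real.cosh_pos (ω * x)).ne'
    have hx : HasDerivAt (fun x => ω * x) ω x := hasDerivAt_const_mul ω
    simp only [Real.tanh_eq_sinh_div_cosh]
    refine ((hx.sinh.fun_div hx.cosh hc).const_mul ω).congr_deriv ?_
    field_simp
  -- The solution vanishes at `-1`, and the reflected one below vanishes at `1`, so only boundary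
  -- terms at `t` survive.
  have el := riccati_sub_le_integral_one (p := fun x => ω * Real.tanh (ω * (1 + x))) h1
    (hac.mono hl) (hd.mono fun x hx hm => hx ⟨hm.1, hm.2.trans_le h2⟩) hil
    (fun x => by simpa using (dt (1 + x)).comp_const_add 1 x)
  have er := riccati_sub_le_integral_one (p := fun x => -(ω * Real.tanh (ω * (1 - x)))) h2
    (hac.mono hr) (hd.mono fun x hx hm => hx ⟨h1.trans_lt hm.1, hm.2⟩) hir
    (fun x => ((dt (1 - x)).comp_const_sub 1 x).fun_neg.congr_deriv (by ring))
  rw [SpaceL.energy_eq hf, ← intervalIntegral.integral_add_adjacent_intervals hil hir]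
  norm_num at el er
  -- Both sides have numerator `sinh (x + y)`, and `cosh x * cosh y ≤ cosh (x + y)` for nonnegative
  -- `x`, `y`.
  have key : Real.tanh (2 * ω) ≤ Real.tanh (ω * (1 + t)) + Real.tanh (ω * (1 - t)) := by
    have hs : 2 * ω = ω * (1 + t) + ω * (1 - t) := by ring
    have hx : 0 ≤ ω * (1 + t) := mul_nonneg hω.le (by linarith)
    have hy : 0 ≤ ω * (1 - t) := mul_nonneg hω.le (by linarith)
    rw [hs]
    generalize ω * (1 + t) = x at *
    generalize ω * (1 - t) = y at *
    have cx := Real.cosh_pos x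
    have cy := Real.cosh_pos y
    have sx := Real.sinh_nonneg_iff.2 hx
    have sy := Real.sinh_nonneg_iff.2 hy
    have cxy := Real.cosh_pos (x + y)
    simp only [Real.tanh_eq_sinh_div_cosh]
    rw [div_add_div _ _ cx.ne' cy.ne', Real.sinh_add, Real.cosh_add]
    refine div_le_div_of_nonneg_left (by positivity) (by positivity) ?_
    linarith [mul_nonneg sx sy]
  have := mul_le_mul_of_nonneg_right (mul_le_mul_of_nonneg_left key hω.le) (sq_nonneg (f t))
  linarith

/-- Lower bound for the second order energy given the value and the slope at a point. -/
lemma SpaceL.stiffForm_le_energy {f : ℝ → ℝ} (hf : f ∈ SpaceL 2 2) (ω : ℝ)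
    {t : ℝ} (ht : t ∈ unitI) :
    stiffForm ω (1 + t) (1 - t) (f t) (dI 1 f t) ≤
      4 * ω ^ 4 * normI 2 f ^ 2 + normI 2 (dI 2 f) ^ 2 := by
  have h1 : (-1 : ℝ) ≤ t := ht.1
  have h2 : t ≤ 1 := ht.2
  obtain ⟨hl, hr⟩ := uIcc_subset_of_mem_unitI ht
  have hac1 : AbsolutelyContinuousOnInterval (dI 1 f) (-1) 1 := hf.2.1
  have hac0 : AbsolutelyContinuousOnInterval f (-1) 1 := by
    refine ContDiffOn.absolutelyContinuousOnInterval ?_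
    rw [uIcc_of_le (by norm_num)]
    exact hf.1
  have hd : ∀ᵐ x, x ∈ Ioo (-1 : ℝ) 1 → HasDerivAt f (dI 1 f x) x := by
    simpa [dI_zero] using ae_hasDerivAt_dI_succ (n := 0) (by simpa [dI_zero] using hac0)
  have hd' := ae_hasDerivAt_dI_succ hac1
  have hi := SpaceL.energy_integrable hf (4 * ω ^ 4)
  have hil := hi.mono_set hl
  have hir := hi.mono_set hr
  have el := riccati_sub_le_integral_two (p := fun x => stiffP ω (1 + x))
    (q := fun x => -stiffQ ω (1 + x)) (s := fun x => stiffS ω (1 + x)) h1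
    (hac0.mono hl) (hac1.mono hl) (hd.mono fun x hx hm => hx ⟨hm.1, hm.2.trans_le h2⟩)
    (hd'.mono fun x hx hm => hx ⟨hm.1, hm.2.trans_le h2⟩) hil
    (fun x => by simpa using (hasDerivAt_stiffP ω (1 + x)).comp_const_add 1 x)
    (fun x => ((hasDerivAt_stiffQ ω (1 + x)).comp_const_add 1 x).fun_neg.congr_deriv
      (by ring))
    (fun x => by simpa using (hasDerivAt_stiffS ω (1 + x)).comp_const_add 1 x)
  -- Reflection reverses the slope, and the boundary term at `t` now enters with a minus sign; the
  -- net effect is that the mixed term has opposite signs on the two sides.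
  have er := riccati_sub_le_integral_two (p := fun x => -stiffP ω (1 - x))
    (q := fun x => -stiffQ ω (1 - x)) (s := fun x => -stiffS ω (1 - x)) h2
    (hac0.mono hr) (hac1.mono hr) (hd.mono fun x hx hm => hx ⟨h1.trans_lt hm.1, hm.2⟩)
    (hd'.mono fun x hx hm => hx ⟨h1.trans_lt hm.1, hm.2⟩) hir
    (fun x => ((hasDerivAt_stiffP ω (1 - x)).comp_const_sub 1 x).fun_neg.congr_deriv
      (by ring))
    (fun x => ((hasDerivAt_stiffQ ω (1 - x)).comp_const_sub 1 x).fun_neg.congr_deriv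
      (by ring))
    (fun x => ((hasDerivAt_stiffS ω (1 - x)).comp_const_sub 1 x).fun_neg.congr_deriv
      (by ring))
  rw [SpaceL.energy_eq hf, ← intervalIntegral.integral_add_adjacent_intervals hil hir, stiffForm]
  norm_num at el er
  linarith

/-! ### Extremal functions -/

lemma contDiff_mem_SpaceL {f : ℝ → ℝ} (hf : ContDiff ℝ (⊤ : ℕ∞) f) (s : ℝ≥0∞) (r : ℕ) :
    f ∈ SpaceL s r := by
  have hs (n : ℕ) : ContDiff ℝ (⊤ : ℕ∞) (iteratedDeriv n f) := by
    rw [iteratedDeriv_eq_iterate]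
    exact hf.iterate_deriv n
  have he (n : ℕ) : EqOn (dI n f) (iteratedDeriv n f) unitI := fun x => dI_eq_iteratedDeriv hf n
  refine ⟨(hf.of_le (by generalize r - 1 = n; exact_mod_cast le_top)).contDiffOn, ?_, ?_⟩
  · refine ContDiffOn.absolutelyContinuousOnInterval ?_
    rw [uIcc_of_le (by norm_num)]
    exact ((hs (r - 1)).of_le (by exact_mod_cast le_top)).contDiffOn.congr (he (r - 1))
  · exact ((hs r).continuous.continuousOn.congr (he r)).memLp_unitI s

lemma eqOn_dI_succ {f g g' : ℝ → ℝ} {n : ℕ} (h : EqOn (dI n f) g unitI)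
    (hg : ∀ x, HasDerivAt g (g' x) x) : EqOn (dI (n + 1) f) g' unitI := by
  intro x hx
  rw [dI_succ, derivWithin_congr h (h hx)]
  exact (hg x).hasDerivWithinAt.derivWithin (uniqueDiffOn_unitI x hx)

lemma energy_eq_of_hasDerivAt {f h W : ℝ → ℝ} {r : ℕ} {c : ℝ} (hf : f ∈ SpaceL 2 r)
    (hh : EqOn (dI r f) h unitI)
    (hW : ∀ x, HasDerivAt W (c * f x ^ 2 + h x ^ 2) x) :
    c * normI 2 f ^ 2 + normI 2 (dI r f) ^ 2 = W 1 - W (-1) := by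
  rw [SpaceL.energy_eq hf]
  refine intervalIntegral.integral_eq_sub_of_hasDerivAt (fun x hx => ?_)
    (SpaceL.energy_integrable hf c)
  rw [uIcc_of_le (by norm_num)] at hx
  rw [hh hx]
  exact hW x

/-- `κ` is the least value of `c ‖f‖ ^ 2 + ‖f^{(r)}‖ ^ 2` subject to `f^{(k)}(-1) = 1`, and it is
no larger than the corresponding value at any other point. -/
def IsEndpointExtremal (r k : ℕ) (c κ : ℝ) : Prop :=
  (∀ f ∈ SpaceL 2 r, ∀ t ∈ unitI,
    κ * dI k f t ^ 2 ≤ c * normI 2 f ^ 2 + normI 2 (dI r f) ^ 2) ∧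
  ∃ g ∈ SpaceL 2 r, dI k g (-1) ≠ 0 ∧
    c * normI 2 g ^ 2 + normI 2 (dI r g) ^ 2 = κ * dI k g (-1) ^ 2

lemma isEndpointExtremal_one_zero {ω : ℝ} (hω : 0 < ω) :
    IsEndpointExtremal 1 0 (ω ^ 2) (ω * Real.tanh (2 * ω)) := by
  refine ⟨fun f hf t ht => by simpa [dI_zero] using SpaceL.tanh_mul_sq_le_energy hf hω ht,
    fun x => Real.cosh (ω * (1 - x)), ?_⟩
  have hz (x : ℝ) : HasDerivAt (fun x => ω * (1 - x)) (-ω) x := by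
    simpa using ((hasDerivAt_id x).const_sub 1).const_mul ω
  have hm : (fun x => Real.cosh (ω * (1 - x))) ∈ SpaceL 2 1 :=
    contDiff_mem_SpaceL (Real.contDiff_cosh.comp (by fun_prop)) 2 1
  have h1 := eqOn_dI_succ (n := 0) (fun x _ => by rw [dI_zero]) fun x => (hz x).cosh
  refine ⟨hm, ?_, ?_⟩
  · rw [dI_zero]
    exact (Real.cosh_pos _).ne'
  · rw [energy_eq_of_hasDerivAt
      -- Since `g'' = ω² g`, the energy density is the derivative of `g g'`, which vanishes at the
      -- free end `1`.
      (W := fun x => -ω * (Real.cosh (ω * (1 - x)) * Real.sinh (ω * (1 - x)))) hm h1 fun x =>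
        (((hz x).cosh.fun_mul (hz x).sinh).const_mul (-ω)).congr_deriv (by ring), dI_zero]
    have e : ω * (1 - -1) = 2 * ω := by ring
    have hc := (Real.cosh_pos (2 * ω)).ne'
    simp only [e, Real.tanh_eq_sinh_div_cosh]
    norm_num
    field_simp

/-- The Krylov function with initial jet `(1, 0, 0, 0)` for the equation `y'''' = -4 y`. -/
noncomputable def krylov₁ (z : ℝ) : ℝ := Real.cosh z * Real.cos z

/-- The Krylov function with initial jet `(0, 1, 0, 0)` for the equation `y'''' = -4 y`. -/
noncomputable def krylov₂ (z : ℝ) : ℝ :=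
  (Real.cosh z * Real.sin z + Real.sinh z * Real.cos z) / 2

/-- The Krylov function with initial jet `(0, 0, 1, 0)` for the equation `y'''' = -4 y`. -/
noncomputable def krylov₃ (z : ℝ) : ℝ := Real.sinh z * Real.sin z / 2

/-- The Krylov function with initial jet `(0, 0, 0, 1)` for the equation `y'''' = -4 y`. -/
noncomputable def krylov₄ (z : ℝ) : ℝ :=
  (Real.cosh z * Real.sin z - Real.sinh z * Real.cos z) / 4

lemma hasDerivAt_krylov₁ (z : ℝ) : HasDerivAt krylov₁ (-4 * krylov₄ z) z :=
  ((Real.hasDerivAt_cosh z).fun_mul (Real.hasDerivAt_cos z)).congr_deriv (by rw [krylov₄]; ring)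

lemma hasDerivAt_krylov₂ (z : ℝ) : HasDerivAt krylov₂ (krylov₁ z) z :=
  ((((Real.hasDerivAt_cosh z).fun_mul (Real.hasDerivAt_sin z)).fun_add
    ((Real.hasDerivAt_sinh z).fun_mul (Real.hasDerivAt_cos z))).div_const 2).congr_deriv
      (by rw [krylov₁]; ring)

lemma hasDerivAt_krylov₃ (z : ℝ) : HasDerivAt krylov₃ (krylov₂ z) z :=
  (((Real.hasDerivAt_sinh z).fun_mul (Real.hasDerivAt_sin z)).div_const 2).congr_deriv
    (by rw [krylov₂])

lemma hasDerivAt_krylov₄ (z : ℝ) : HasDerivAt krylov₄ (krylov₃ z) z :=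
  ((((Real.hasDerivAt_cosh z).fun_mul (Real.hasDerivAt_sin z)).fun_sub
    ((Real.hasDerivAt_sinh z).fun_mul (Real.hasDerivAt_cos z))).div_const 4).congr_deriv
      (by rw [krylov₃]; ring)

/-- The value at `-1` of the extremal for `k = 0`. -/
lemma krylov_value_identity (ω : ℝ) :
    krylov₁ (2 * ω) * krylov₄ (2 * ω) - krylov₂ (2 * ω) * krylov₃ (2 * ω) =
      -(Real.sinh (4 * ω) - Real.sin (4 * ω)) / 8 := by
  rw [show 4 * ω = 2 * (2 * ω) by ring, Real.sinh_two_mul, Real.sin_two_mul, krylov₁, krylov₂,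
    krylov₃, krylov₄]
  have h1 := Real.cosh_sq (2 * ω)
  have h2 := Real.sin_sq_add_cos_sq (2 * ω)
  linear_combination (Real.sin (2 * ω) * Real.cos (2 * ω) / 4) * h1 -
    (Real.sinh (2 * ω) * Real.cosh (2 * ω) / 4) * h2

/-- Up to the factor `ω`, the slope at `-1` of the extremal for `k = 1`. -/
lemma krylov_slope_identity (ω : ℝ) :
    4 * krylov₃ (2 * ω) * krylov₄ (2 * ω) + krylov₁ (2 * ω) * krylov₂ (2 * ω) =
      (Real.sinh (4 * ω) + Real.sin (4 * ω)) / 4 := by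
  rw [show 4 * ω = 2 * (2 * ω) by ring, Real.sinh_two_mul, Real.sin_two_mul, krylov₁, krylov₂,
    krylov₃, krylov₄]
  have h1 := Real.cosh_sq (2 * ω)
  have h2 := Real.sin_sq_add_cos_sq (2 * ω)
  linear_combination (Real.sin (2 * ω) * Real.cos (2 * ω) / 2) * h1 +
    (Real.sinh (2 * ω) * Real.cosh (2 * ω) / 2) * h2

/-- Up to factors depending on `ω`, this is the third derivative at `-1` of the extremal for `k = 0`
and the second derivative at `-1` of the one for `k = 1`. -/
lemma krylov_determinant_identity (ω : ℝ) :
    krylov₂ (2 * ω) * krylov₄ (2 * ω) - krylov₃ (2 * ω) ^ 2 =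
      -(Real.cosh (4 * ω) + Real.cos (4 * ω) - 2) / 16 := by
  rw [show 4 * ω = 2 * (2 * ω) by ring, Real.cosh_two_mul, Real.cos_two_mul, krylov₂,
    krylov₃, krylov₄]
  have h1 := Real.cosh_sq (2 * ω)
  have h2 := Real.sin_sq_add_cos_sq (2 * ω)
  linear_combination ((Real.sin (2 * ω) ^ 2 + 1 / 2) / 8) * h1 -
    ((Real.sinh (2 * ω) ^ 2 - 1) / 8) * h2

/-- A deflection of the beam that is free at the right end, with its energy. -/
lemma exists_free_beam {ω : ℝ} (α β : ℝ) :
    ∃ g ∈ SpaceL 2 2,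
      dI 0 g (-1) = α * krylov₁ (2 * ω) + β * krylov₂ (2 * ω) ∧
      dI 1 g (-1) = -ω * (-4 * α * krylov₄ (2 * ω) + β * krylov₁ (2 * ω)) ∧
      4 * ω ^ 4 * normI 2 g ^ 2 + normI 2 (dI 2 g) ^ 2 =
        4 * ω ^ 3 * (α * krylov₂ (2 * ω) + β * krylov₃ (2 * ω)) *
            (α * krylov₁ (2 * ω) + β * krylov₂ (2 * ω)) -
          4 * ω ^ 3 * (α * krylov₃ (2 * ω) + β * krylov₄ (2 * ω)) *
            (-4 * α * krylov₄ (2 * ω) + β * krylov₁ (2 * ω)) := by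
  have hz (x : ℝ) : HasDerivAt (fun x => ω * (1 - x)) (-ω) x := by
    simpa using ((hasDerivAt_id x).const_sub 1).const_mul ω
  have k1 (x : ℝ) := (hasDerivAt_krylov₁ (ω * (1 - x))).comp x (hz x)
  have k2 (x : ℝ) := (hasDerivAt_krylov₂ (ω * (1 - x))).comp x (hz x)
  have k3 (x : ℝ) := (hasDerivAt_krylov₃ (ω * (1 - x))).comp x (hz x)
  have k4 (x : ℝ) := (hasDerivAt_krylov₄ (ω * (1 - x))).comp x (hz x)
  let g₀ : ℝ → ℝ := fun x => α * krylov₁ (ω * (1 - x)) + β * krylov₂ (ω * (1 - x))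
  let g₁ : ℝ → ℝ := fun x =>
    -ω * (-4 * α * krylov₄ (ω * (1 - x)) + β * krylov₁ (ω * (1 - x)))
  let g₂ : ℝ → ℝ := fun x =>
    -4 * ω ^ 2 * (α * krylov₃ (ω * (1 - x)) + β * krylov₄ (ω * (1 - x)))
  let g₃ : ℝ → ℝ := fun x =>
    4 * ω ^ 3 * (α * krylov₂ (ω * (1 - x)) + β * krylov₃ (ω * (1 - x)))
  have d0 (x : ℝ) : HasDerivAt g₀ (g₁ x) x :=
    (((k1 x).const_mul α).fun_add ((k2 x).const_mul β)).congr_deriv (by simp only [g₁]; ring)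
  have d1 (x : ℝ) : HasDerivAt g₁ (g₂ x) x :=
    ((((k4 x).const_mul (-4 * α)).fun_add ((k1 x).const_mul β)).const_mul (-ω)).congr_deriv
      (by simp only [g₂]; ring)
  have d2 (x : ℝ) : HasDerivAt g₂ (g₃ x) x :=
    ((((k3 x).const_mul α).fun_add ((k4 x).const_mul β)).const_mul (-4 * ω ^ 2)).congr_deriv
      (by simp only [g₃]; ring)
  have d3 (x : ℝ) : HasDerivAt g₃ (-4 * ω ^ 4 * g₀ x) x :=
    ((((k2 x).const_mul α).fun_add ((k3 x).const_mul β)).const_mul (4 * ω ^ 3)).congr_deriv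
      (by simp only [g₀]; ring)
  have hsm : ContDiff ℝ (⊤ : ℕ∞) g₀ := by
    have l : ContDiff ℝ (⊤ : ℕ∞) fun x : ℝ => ω * (1 - x) := by fun_prop
    exact (contDiff_const.mul (l.cosh.mul l.cos)).add
      (contDiff_const.mul (((l.cosh.mul l.sin).add (l.sinh.mul l.cos)).div_const 2))
  have hm := contDiff_mem_SpaceL hsm 2 2
  have h1 := eqOn_dI_succ (n := 0) (fun x _ => by rw [dI_zero]) d0
  have h2 := eqOn_dI_succ h1 d1
  have e : ω * (1 - -1) = 2 * ω := by ring
  refine ⟨g₀, hm, ?_, ?_, ?_⟩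
  · simp only [dI_zero, g₀, e]
  · rw [h1 ⟨le_rfl, by norm_num⟩]
    simp only [g₁, e]
  -- Two integrations by parts using `g'''' = -4 ω⁴ g`. The contribution at `1` vanishes because
  -- `g''` and `g'''` do.
  · rw [energy_eq_of_hasDerivAt (W := fun x => g₂ x * g₁ x - g₃ x * g₀ x) hm h2 fun x =>
      (((d2 x).fun_mul (d1 x)).fun_sub ((d3 x).fun_mul (d0 x))).congr_deriv (by ring)]
    simp only [g₀, g₁, g₂, g₃, e, krylov₂, krylov₃, krylov₄]
    norm_num
    ring

lemma isEndpointExtremal_two_zero {ω : ℝ} (hω : 0 < ω) :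
    IsEndpointExtremal 2 0 (4 * ω ^ 4)
      (2 * ω ^ 3 * (Real.cosh (4 * ω) + Real.cos (4 * ω) - 2) /
        (Real.sinh (4 * ω) - Real.sin (4 * ω))) := by
  have hδ : 0 < Real.sinh (4 * ω) - Real.sin (4 * ω) :=
    sub_pos.2 ((le_abs_self _).trans_lt (abs_sin_lt_sinh (by positivity)))
  refine ⟨fun f hf t ht => ?_, ?_⟩
  · have h := SpaceL.stiffForm_le_energy hf ω ht
    have h' := (le_stiffForm hω (by linarith [ht.1]) (by linarith [ht.2]) (by ring)
      (f t) (dI 1 f t) (L₁ := 1 + t) (L₂ := 1 - t)).1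
    rw [dI_zero, div_mul_eq_mul_div, div_le_iff₀ hδ]
    linarith [mul_le_mul_of_nonneg_left h hδ.le]
  -- The slope at `-1` is unconstrained, so the natural boundary condition is `g''(-1) = 0`, that is
  -- `α krylov₃ + β krylov₄ = 0` at `2 ω`.
  · obtain ⟨g, hg, h0, -, he⟩ :=
      exists_free_beam (ω := ω) (krylov₄ (2 * ω)) (-krylov₃ (2 * ω))
    have hv := krylov_value_identity ω
    have hd := krylov_determinant_identity ω
    have h0' : dI 0 g (-1) = -(Real.sinh (4 * ω) - Real.sin (4 * ω)) / 8 := by linarith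
    refine ⟨g, hg, ?_, ?_⟩
    · rw [h0']
      exact (div_neg_of_neg_of_pos (neg_neg_of_pos hδ) (by norm_num)).ne
    · have he' : 4 * ω ^ 4 * normI 2 g ^ 2 + normI 2 (dI 2 g) ^ 2 =
          ω ^ 3 * (Real.cosh (4 * ω) + Real.cos (4 * ω) - 2) *
            (Real.sinh (4 * ω) - Real.sin (4 * ω)) / 32 := by
        linear_combination he + 4 * ω ^ 3 *
          (krylov₁ (2 * ω) * krylov₄ (2 * ω) - krylov₂ (2 * ω) * krylov₃ (2 * ω)) * hd +
          4 * ω ^ 3 * (-(Real.cosh (4 * ω) + Real.cos (4 * ω) - 2) / 16) * hv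
      rw [he', h0']
      generalize Real.sinh (4 * ω) - Real.sin (4 * ω) = δ at *
      field_simp
      ring

lemma isEndpointExtremal_two_one {ω : ℝ} (hω : 0 < ω) :
    IsEndpointExtremal 2 1 (4 * ω ^ 4)
      (ω * (Real.cosh (4 * ω) + Real.cos (4 * ω) - 2) /
        (Real.sinh (4 * ω) + Real.sin (4 * ω))) := by
  have hδ : 0 < Real.sinh (4 * ω) + Real.sin (4 * ω) := by
    linarith [(neg_le_abs _).trans_lt (abs_sin_lt_sinh (by positivity : 0 < 4 * ω))]
  refine ⟨fun f hf t ht => ?_, ?_⟩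
  · have h := SpaceL.stiffForm_le_energy hf ω ht
    have h' := (le_stiffForm hω (by linarith [ht.1]) (by linarith [ht.2]) (by ring)
      (f t) (dI 1 f t) (L₁ := 1 + t) (L₂ := 1 - t)).2
    rw [div_mul_eq_mul_div, div_le_iff₀ hδ]
    linarith [mul_le_mul_of_nonneg_left h hδ.le]
  -- Here the value at `-1` is unconstrained, so the natural condition is `g'''(-1) = 0`, that is `α
  -- krylov₂ + β krylov₃ = 0` at `2 ω`.
  · obtain ⟨g, hg, -, h1, he⟩ :=
      exists_free_beam (ω := ω) (krylov₃ (2 * ω)) (-krylov₂ (2 * ω))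
    have hs := krylov_slope_identity ω
    have hd := krylov_determinant_identity ω
    have h1' : dI 1 g (-1) = ω * (Real.sinh (4 * ω) + Real.sin (4 * ω)) / 4 := by
      linear_combination h1 + ω * hs
    refine ⟨g, hg, ?_, ?_⟩
    · rw [h1']
      positivity
    · have he' : 4 * ω ^ 4 * normI 2 g ^ 2 + normI 2 (dI 2 g) ^ 2 =
          ω ^ 3 * (Real.cosh (4 * ω) + Real.cos (4 * ω) - 2) *
            (Real.sinh (4 * ω) + Real.sin (4 * ω)) / 16 := by
        linear_combination he - 4 * ω ^ 3 *
          (4 * krylov₃ (2 * ω) * krylov₄ (2 * ω) + krylov₁ (2 * ω) * krylov₂ (2 * ω)) * hd -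
          4 * ω ^ 3 * (-(Real.cosh (4 * ω) + Real.cos (4 * ω) - 2) / 16) * hs
      rw [he', h1']
      generalize Real.sinh (4 * ω) + Real.sin (4 * ω) = δ at *
      field_simp
      ring

lemma exists_isEndpointExtremal {r k : ℕ} (h : (r = 1 ∧ k = 0) ∨ (r = 2 ∧ (k = 0 ∨ k = 1)))
    {c : ℝ} (hc : 0 < c) : ∃ κ, IsEndpointExtremal r k c κ := by
  have hω : ∃ ω > 0, 4 * ω ^ 4 = c := by
    refine ⟨√√(c / 4), by positivity, ?_⟩
    rw [show 4 = 2 * 2 from rfl, pow_mul, Real.sq_sqrt (by positivity),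
      Real.sq_sqrt (by positivity)]
    ring
  obtain ⟨rfl, rfl⟩ | ⟨rfl, rfl | rfl⟩ := h
  · have := isEndpointExtremal_one_zero (Real.sqrt_pos.2 hc)
    rw [Real.sq_sqrt hc.le] at this
    exact ⟨_, this⟩
  · obtain ⟨ω, hω, rfl⟩ := hω
    exact ⟨_, isEndpointExtremal_two_zero hω⟩
  · obtain ⟨ω, hω, rfl⟩ := hω
    exact ⟨_, isEndpointExtremal_two_one hω⟩

/-! ### From quadratic to additive inequalities -/

/-- Cauchy–Schwarz with weights chosen so that equality holds when `(X, Y)` is proportional to `(x,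
y)`. -/
lemma sq_add_mul_le {a b x y X Y : ℝ} (ha : 0 < a) (hb : 0 < b) (hx : 0 < x) (hy : 0 < y) :
    (a * X + b * Y) ^ 2 ≤
      b * (a * x + b * y) / y * (a * y / (b * x) * X ^ 2 + Y ^ 2) := by
  have : b * (a * x + b * y) / y * (a * y / (b * x) * X ^ 2 + Y ^ 2) - (a * X + b * Y) ^ 2 =
      a * b / (x * y) * (y * X - x * Y) ^ 2 := by
    field_simp
    ring
  have h : 0 ≤ a * b / (x * y) * (y * X - x * Y) ^ 2 := by positivity
  linarith

lemma abs_dI_le_of_endpoint_of_pos {r k : ℕ} (hE : ∀ c > 0, ∃ κ, IsEndpointExtremal r k c κ)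
    {a b : ℝ} (ha : 0 < a) (hb : 0 < b)
    (h : ∀ g ∈ SpaceL 2 r, |dI k g (-1)| ≤ a * normI 2 g + b * normI 2 (dI r g))
    {f : ℝ → ℝ} (hf : f ∈ SpaceL 2 r) {t : ℝ} (ht : t ∈ unitI) {x y : ℝ}
    (hx : 0 < x) (hy : 0 < y) (hfx : normI 2 f ≤ x) (hfy : normI 2 (dI r f) ≤ y) :
    |dI k f t| ≤ a * x + b * y := by
  -- This `c` is the weight for which Cauchy–Schwarz is an equality at `(x, y)`, so the final return
  -- to the additive form loses nothing.
  obtain ⟨κ, hle, g, hg, hg0, hge⟩ := hE (a * y / (b * x)) (by positivity)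
  have hS : 0 < a * x + b * y := by positivity
  have hβ : 0 < b * (a * x + b * y) / y := by positivity
  -- Testing the hypothesis on the extremal `g` bounds `κ` from below.
  have h1 : 1 ≤ b * (a * x + b * y) / y * κ := by
    have e1 := pow_le_pow_left₀ (abs_nonneg _) (h g hg) 2
    have e2 := e1.trans (sq_add_mul_le ha hb hx hy)
    rw [hge, sq_abs, ← mul_assoc] at e2
    exact le_of_mul_le_mul_right (by linarith) (by positivity : 0 < dI k g (-1) ^ 2)
  refine abs_le_of_sq_le_sq ?_ hS.le
  have e1 : normI 2 f ^ 2 ≤ x ^ 2 := pow_le_pow_left₀ (normI_nonneg _ _) hfx 2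
  have e2 : normI 2 (dI r f) ^ 2 ≤ y ^ 2 := pow_le_pow_left₀ (normI_nonneg _ _) hfy 2
  calc dI k f t ^ 2 ≤ b * (a * x + b * y) / y * κ * dI k f t ^ 2 :=
        le_mul_of_one_le_left (sq_nonneg _) h1
    _ = b * (a * x + b * y) / y * (κ * dI k f t ^ 2) := by ring
    _ ≤ b * (a * x + b * y) / y * (a * y / (b * x) * x ^ 2 + y ^ 2) := by
        refine mul_le_mul_of_nonneg_left ((hle f hf t ht).trans ?_) hβ.le
        gcongr
    _ = (a * x + b * y) ^ 2 := by
        field_simp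

lemma abs_dI_le_of_endpoint {r k : ℕ} (hE : ∀ c > 0, ∃ κ, IsEndpointExtremal r k c κ)
    {A B : ℝ} (hA : 0 ≤ A) (hB : 0 ≤ B)
    (h : ∀ g ∈ SpaceL 2 r, |dI k g (-1)| ≤ A * normI 2 g + B * normI 2 (dI r g))
    {f : ℝ → ℝ} (hf : f ∈ SpaceL 2 r) {t : ℝ} (ht : t ∈ unitI) :
    |dI k f t| ≤ A * normI 2 f + B * normI 2 (dI r f) := by
  -- The weight above needs positive constants and positive norm bounds; all four are raised by `ε`,
  -- which then tends to zero.
  have hlim : Filter.Tendsto (fun ε : ℝ => (A + ε) * (normI 2 f + ε) +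
      (B + ε) * (normI 2 (dI r f) + ε)) (nhdsWithin 0 (Ioi 0))
      (nhds (A * normI 2 f + B * normI 2 (dI r f))) := by
    refine tendsto_nhdsWithin_of_tendsto_nhds ?_
    have : Continuous fun ε : ℝ => (A + ε) * (normI 2 f + ε) +
      (B + ε) * (normI 2 (dI r f) + ε) := by fun_prop
    simpa using this.tendsto 0
  refine ge_of_tendsto hlim ?_
  filter_upwards [self_mem_nhdsWithin] with ε hε
  have hε : 0 < ε := hε
  have n1 := normI_nonneg 2 f
  have n2 := normI_nonneg 2 (dI r f)
  refine abs_dI_le_of_endpoint_of_pos hE (by positivity) (by positivity) (fun g hg => ?_) hf ht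
    (by positivity) (by positivity) (by linarith) (by linarith)
  have m1 := normI_nonneg 2 g
  have m2 := normI_nonneg 2 (dI r g)
  refine (h g hg).trans ?_
  gcongr <;> linarith

/-! ### The uniform norm -/

lemma normI_top_le {f : ℝ → ℝ} {M : ℝ} (hM : 0 ≤ M) (h : ∀ t ∈ unitI, |f t| ≤ M) :
    normI ∞ f ≤ M := by
  refine ENNReal.toReal_le_of_le_ofReal hM ?_
  rw [eLpNorm_exponent_top]
  exact eLpNormEssSup_le_of_ae_bound ((ae_restrict_iff' measurableSet_Icc).2 (.of_forall h))

lemma abs_le_normI_top {f : ℝ → ℝ} (hf : ContinuousOn f unitI) {t : ℝ} (ht : t ∈ unitI) :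
    |f t| ≤ normI ∞ f := by
  -- The essential bound is recast as an almost everywhere equality of continuous functions, which
  -- then holds at every point of the interval.
  have hae : (fun x => min |f x| (normI ∞ f)) =ᵐ[volume.restrict (Icc (-1) 1)]
      fun x => |f x| := by
    have hfin := (hf.memLp_unitI ∞).eLpNorm_ne_top
    filter_upwards [ae_le_eLpNormEssSup (f := f) (μ := volume.restrict unitI)] with x hx
    rw [← eLpNorm_exponent_top] at hx
    have := ENNReal.toReal_mono hfin hx
    rw [toReal_enorm, Real.norm_eq_abs] at this
    exact min_eq_left this
  have := Measure.eqOn_Icc_of_ae_eq volume (by norm_num) hae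
    (ContinuousOn.inf hf.abs continuousOn_const) hf.abs ht
  exact min_eq_left_iff.1 this

/-! ### Homogeneity -/

lemma dI_smul (k : ℕ) (a : ℝ) (f : ℝ → ℝ) : dI k (a • f) = a • dI k f :=
  funext fun _ => iteratedDerivWithin_const_smul_field a f

lemma normI_smul (p : ℝ≥0∞) (a : ℝ) (f : ℝ → ℝ) : normI p (a • f) = |a| * normI p f := by
  rw [normI, eLpNorm_const_smul, ENNReal.toReal_mul, toReal_enorm, Real.norm_eq_abs, normI]

lemma smul_mem_SpaceL {s : ℝ≥0∞} {r : ℕ} {f : ℝ → ℝ} (hf : f ∈ SpaceL s r) (a : ℝ) :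
    a • f ∈ SpaceL s r := by
  refine ⟨hf.1.const_smul a, ?_, ?_⟩
  · rw [dI_smul]
    exact hf.2.1.const_smul a
  · rw [dI_smul]
    exact hf.2.2.const_smul a

/-- Scaling `f` to `‖f^{(r)}‖ = 1` passes between the class and the whole space, so the supremum
condition carries no information beyond the inequalities. -/
lemma mem_upperBounds_sharp_iff {p s : ℝ≥0∞} {r : ℕ} {T : (ℝ → ℝ) → ℝ}
    (hT : ∀ (a : ℝ) (f : ℝ → ℝ), T (a • f) = |a| * T f) {A M : ℝ} :
    M ∈ upperBounds {y : ℝ | ∃ f ∈ ClassW s r, y = T f - A * normI p f} ↔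
      0 ≤ M ∧ ∀ f ∈ SpaceL s r, T f ≤ A * normI p f + M * normI s (dI r f) := by
  constructor
  · intro h
    have hW (f : ℝ → ℝ) (hf : f ∈ SpaceL s r) (a : ℝ) (ha : 0 ≤ a)
        (h1 : a * normI s (dI r f) ≤ 1) : a * (T f - A * normI p f) ≤ M := by
      refine h ⟨a • f, ⟨smul_mem_SpaceL hf a, ?_⟩, ?_⟩
      · rwa [dI_smul, normI_smul, abs_of_nonneg ha]
      · rw [hT, normI_smul, abs_of_nonneg ha]
        ring
    have h0 : 0 ≤ M := by
      simpa using hW 0 (contDiff_mem_SpaceL contDiff_const s r) 0 le_rfl (by simp)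
    refine ⟨h0, fun f hf => ?_⟩
    rcases (normI_nonneg s (dI r f)).eq_or_lt with hY | hY
    · rw [← hY]
      by_contra! hlt
      have hd : 0 < T f - A * normI p f := by linarith
      -- When `‖f^{(r)}‖ = 0` every multiple of `f` stays in the class; this factor would produce
      -- the value `M + 1`.
      have := hW f hf ((M + 1) / (T f - A * normI p f)) (by positivity) (by simp [← hY])
      rw [div_mul_cancel₀ _ hd.ne'] at this
      linarith
    · have := hW f hf (normI s (dI r f))⁻¹ (by positivity) (by rw [inv_mul_cancel₀ hY.ne'])
      rw [inv_mul_le_iff₀ hY] at this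
      linarith
  · rintro ⟨h0, h⟩ _ ⟨f, hf, rfl⟩
    linarith [h f hf.1, mul_le_of_le_one_right h0 hf.2]

lemma sharpPairs_congr {p s : ℝ≥0∞} {r : ℕ} {T T' : (ℝ → ℝ) → ℝ}
    (hT : ∀ (a : ℝ) (f : ℝ → ℝ), T (a • f) = |a| * T f)
    (hT' : ∀ (a : ℝ) (f : ℝ → ℝ), T' (a • f) = |a| * T' f)
    (h : ∀ A B : ℝ, 0 ≤ A → 0 ≤ B →
      ((∀ f ∈ SpaceL s r, T f ≤ A * normI p f + B * normI s (dI r f)) ↔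
        ∀ f ∈ SpaceL s r, T' f ≤ A * normI p f + B * normI s (dI r f))) :
    sharpPairs p s r T = sharpPairs p s r T' := by
  ext ⟨A, B⟩
  refine and_congr_right fun hA => and_congr_right fun hB => and_congr (h A B hA hB) ?_
  rw [IsLUB, IsLUB]
  refine iff_of_eq (congrArg (fun s => IsLeast s B) (Set.ext fun M => ?_))
  rw [mem_upperBounds_sharp_iff hT, mem_upperBounds_sharp_iff hT']
  exact and_congr_right fun hM => h A M hA hM

theorem mainTheorem8 (r k : ℕ) (h : (r = 1 ∧ k = 0) ∨ (r = 2 ∧ (k = 0 ∨ k = 1))) :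
    Gam r k = GamAt r k (-1) := by
  have hk : k ≤ r - 1 := by omega
  refine sharpPairs_congr (fun a f => by rw [dI_smul, normI_smul])
    (fun a f => by rw [dI_smul, Pi.smul_apply, smul_eq_mul, abs_mul]) fun A B hA hB => ?_
  constructor
  · intro H f hf
    exact (abs_le_normI_top (SpaceL.continuousOn_dI hf hk) ⟨le_rfl, by norm_num⟩).trans (H f hf)
  · intro H f hf
    have n1 := normI_nonneg 2 f
    have n2 := normI_nonneg 2 (dI r f)
    exact normI_top_le (by positivity) fun t ht =>
      abs_dI_le_of_endpoint (fun c hc => exists_isEndpointExtremal h hc) hA hB H hf ht
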